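/- Let $G=(V,E)$ be a finite simple graph. Let $\mathfrak n_G = W_0\oplus W_1$, where $W_0$ is the real vector space with basis $V$ and $W_1\subseteq\bigwedge^2 W_0$ is the subspace spanned by the elements $v\wedge w$ with $v,w\in V$ adjacent. Equip $\mathfrak n_G$ with the Lie bracket for which $[v,w]=v\wedge w$ if $v,w\in V$ are adjacent, $[v,w]=0$ if $v,w\in V$ are not adjacent, and $W_1$ is central. Vertices are regarded as elements of $W_0$, and an edge $\{v,w\}$ is identified with $v\wedge w\in W_1$, which is defined up to sign. A complex structure on $\mathfrak n_G$ is a linear map $J:\mathfrak n_G\to\mathfrak n_G$ with $J^2=-\mathrm{Id}$ and $$[x,y]+J([Jx,y]+[x,Jy])-[Jx,Jy]=0\qquad\text{for all } x,y\in\mathfrak n_G.$$ It is called adapted if for every $x\in V\cup E$ one has, up to sign, $Jx\in V\cup E$. We say that $G$ admits an adapted complex structure if $\mathfrak n_G$ carries one. **Theorem.** Let $G$ be a finite forest, that is, a finite simple graph with no cycles. Then the following are equivalent: (i) $G$ admits an adapted complex structure; (ii) $G$ has an even number of connected components, and each connected component has at most one vertex of even degree. -/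

import Mathlib

/-! ## Complex structures on real Lie algebras -/

/-- A complex structure on a real Lie algebra `L`: a linear endomorphism `J` with `J² = -Id`
whose Nijenhuis tensor `N_J(x, y) = [x, y] + J([Jx, y] + [x, Jy]) - [Jx, Jy]` vanishes. -/
structure IsComplexStructure {L : Type*} [LieRing L] [LieAlgebra ℝ L] (J : L →ₗ[ℝ] L) : Prop where
  sq_eq_neg : ∀ x : L, J (J x) = -x
  nijenhuis_eq_zero : ∀ x y : L, ⁅x, y⁆ + J (⁅J x, y⁆ + ⁅x, J y⁆) - ⁅J x, J y⁆ = 0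

/-! ## The 2-step nilpotent Lie algebra of a finite graph -/

namespace SimpleGraph

noncomputable section

variable {V : Type*}

/-- The element `v ∧ w` of the second exterior power of the real vector space generated by `V`. -/
def wedge (v w : V) : ⋀[ℝ]^2 (V →₀ ℝ) :=
  exteriorPower.ιMulti ℝ 2 ![Finsupp.single v 1, Finsupp.single w 1]

theorem wedge_swap (v w : V) : wedge w v = -wedge v w := by
  have h := (exteriorPower.ιMulti ℝ 2 (M := V →₀ ℝ)).map_swap
    ![Finsupp.single v 1, Finsupp.single w 1] (i := 0) (j := 1) (by decide)
  rw [wedge, wedge, ← h]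
  congr 1
  ext i
  fin_cases i <;> rfl

/-- The subspace of the second exterior power spanned by the `v ∧ w` with `v`, `w` adjacent. -/
def edgeSpace (G : SimpleGraph V) : Submodule ℝ (⋀[ℝ]^2 (V →₀ ℝ)) :=
  Submodule.span ℝ {z | ∃ v w : V, G.Adj v w ∧ z = wedge v w}

/-- The element `v ∧ w` of the edge space, for adjacent `v` and `w`. -/
def edgeWedge (G : SimpleGraph V) {v w : V} (h : G.Adj v w) : G.edgeSpace :=
  ⟨wedge v w, Submodule.subset_span ⟨v, w, h, rfl⟩⟩

open Classical in
/-- The value of the bracket on two vertices: `v ∧ w` if they are adjacent, and `0` otherwise. -/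
def vertexBracket (G : SimpleGraph V) (v w : V) : G.edgeSpace :=
  if h : G.Adj v w then G.edgeWedge h else 0

theorem vertexBracket_add_swap (G : SimpleGraph V) (v w : V) :
    G.vertexBracket v w + G.vertexBracket w v = 0 := by
  by_cases h : G.Adj v w
  · simp only [vertexBracket, h, h.symm, dite_true]
    refine Subtype.ext ?_
    change wedge v w + wedge w v = 0
    rw [wedge_swap v w, add_neg_cancel]
  · have h' : ¬ G.Adj w v := fun k => h k.symm
    simp [vertexBracket, h, h']

/-- The underlying space of the Lie algebra of `G`: the direct sum of the real vector space
generated by the vertices and the edge space. -/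
def LieAlg (G : SimpleGraph V) : Type _ := (V →₀ ℝ) × G.edgeSpace

instance (G : SimpleGraph V) : AddCommGroup G.LieAlg :=
  inferInstanceAs (AddCommGroup ((V →₀ ℝ) × G.edgeSpace))

instance (G : SimpleGraph V) : Module ℝ G.LieAlg :=
  inferInstanceAs (Module ℝ ((V →₀ ℝ) × G.edgeSpace))

/-- The bilinear extension of the bracket of vertices. -/
def bracketAux [Fintype V] (G : SimpleGraph V) (x y : V →₀ ℝ) : G.edgeSpace :=
  ∑ v, ∑ w, (x v * y w) • G.vertexBracket v w

/-- The Lie bracket: bilinear, given on vertices by `vertexBracket`, with central edge space. -/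
instance [Fintype V] (G : SimpleGraph V) : Bracket G.LieAlg G.LieAlg :=
  ⟨fun x y => ((0 : V →₀ ℝ), G.bracketAux x.1 y.1)⟩

theorem bracketAux_self [Fintype V] (G : SimpleGraph V) (x : V →₀ ℝ) : G.bracketAux x x = 0 := by
  have h : G.bracketAux x x + G.bracketAux x x = 0 := by
    conv_lhs => rw [bracketAux]; arg 2; rw [Finset.sum_comm]
    rw [← Finset.sum_add_distrib]
    refine Finset.sum_eq_zero fun v _ => ?_
    rw [← Finset.sum_add_distrib]
    refine Finset.sum_eq_zero fun w _ => ?_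
    rw [mul_comm (x w), ← smul_add, vertexBracket_add_swap, smul_zero]
  rw [← two_smul ℝ] at h
  exact (smul_eq_zero.mp h).resolve_left two_ne_zero

theorem bracketAux_zero_left [Fintype V] (G : SimpleGraph V) (y : V →₀ ℝ) :
    G.bracketAux 0 y = 0 := by
  simp [bracketAux]

theorem bracketAux_zero_right [Fintype V] (G : SimpleGraph V) (x : V →₀ ℝ) :
    G.bracketAux x 0 = 0 := by
  simp [bracketAux]

instance [Fintype V] (G : SimpleGraph V) : LieRing G.LieAlg where
  add_lie x y z := Prod.ext (add_zero (0 : V →₀ ℝ)).symm <| by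
    change G.bracketAux (x.1 + y.1) z.1 = G.bracketAux x.1 z.1 + G.bracketAux y.1 z.1
    simp [bracketAux, add_mul, add_smul, Finset.sum_add_distrib]
  lie_add x y z := Prod.ext (add_zero (0 : V →₀ ℝ)).symm <| by
    change G.bracketAux x.1 (y.1 + z.1) = G.bracketAux x.1 y.1 + G.bracketAux x.1 z.1
    simp [bracketAux, mul_add, add_smul, Finset.sum_add_distrib]
  lie_self x := Prod.ext rfl (G.bracketAux_self x.1)
  leibniz_lie x y z := Prod.ext (add_zero (0 : V →₀ ℝ)).symm <| by
    change G.bracketAux x.1 0 = G.bracketAux 0 z.1 + G.bracketAux y.1 0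
    simp [bracketAux_zero_left, bracketAux_zero_right]

instance [Fintype V] (G : SimpleGraph V) : LieAlgebra ℝ G.LieAlg where
  lie_smul t x y := Prod.ext (smul_zero t).symm <| by
    change G.bracketAux x.1 (t • y.1) = t • G.bracketAux x.1 y.1
    simp [bracketAux, Finset.smul_sum, smul_smul, mul_left_comm]

/-- A vertex, as an element of the Lie algebra. -/
def vertexVec (G : SimpleGraph V) (v : V) : G.LieAlg := (Finsupp.single v 1, 0)

/-- The edge joining `v` and `w`, oriented from `v` to `w`, as the element `v ∧ w` of the Lie
algebra. The opposite orientation gives the negative of this element. -/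
def edgeVec (G : SimpleGraph V) {v w : V} (h : G.Adj v w) : G.LieAlg := (0, G.edgeWedge h)

theorem lie_vertexVec [Fintype V] (G : SimpleGraph V) {v w : V} (h : G.Adj v w) :
    ⁅G.vertexVec v, G.vertexVec w⁆ = G.edgeVec h := by
  classical
  refine Prod.ext rfl ?_
  change G.bracketAux (Finsupp.single v 1) (Finsupp.single w 1) = G.edgeWedge h
  rw [bracketAux, Finset.sum_eq_single v, Finset.sum_eq_single w]
  · simp [vertexBracket, h]
  · intro b _ hb
    simp [hb.symm]
  · simp
  · intro b _ hb
    simp [hb.symm]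
  · simp

/-- The vertices and the edges in the Lie algebra. Each edge is listed with both orientations,
that is, with both signs; being adapted does not depend on the choice of orientations, because it
only speaks of vertices and edges up to sign. -/
def vertexEdgeSet (G : SimpleGraph V) : Set G.LieAlg :=
  {x | (∃ v : V, x = G.vertexVec v) ∨ ∃ (v w : V) (h : G.Adj v w), x = G.edgeVec h}

/-- A complex structure on the Lie algebra of `G` is adapted if it sends every vertex and every
edge to a vertex or an edge, up to sign. -/
structure IsAdaptedComplexStructure [Fintype V] (G : SimpleGraph V)
    (J : G.LieAlg →ₗ[ℝ] G.LieAlg) : Prop where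
  isComplexStructure : IsComplexStructure J
  adapted : ∀ x ∈ G.vertexEdgeSet, J x ∈ G.vertexEdgeSet ∨ -J x ∈ G.vertexEdgeSet

/-- `G` admits an adapted complex structure. -/
def AdmitsAdaptedComplexStructure [Fintype V] (G : SimpleGraph V) : Prop :=
  ∃ J : G.LieAlg →ₗ[ℝ] G.LieAlg, G.IsAdaptedComplexStructure J

end

end SimpleGraph

namespace SimpleGraph

/-! ### Parity and pairings -/

/-! Necessity. An adapted `J` induces an involution `τ` of the vertices: `J v = ±τ v`, with `τ v =
v` when `J v` is an edge up to sign. For adjacent `v`, `u` with `u ≠ τ v`, the `v ∧ u` coordinate of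
the Nijenhuis tensor can vanish only if `v` is adjacent to `τ u ≠ u` or `u` is adjacent to `τ v ≠ v`
(`IsAdaptedComplexStructure.adj_or_adj`). In a forest this rule propagates. Along a path leaving a
vertex of even degree, each later vertex `u` has a predecessor adjacent to both `u` and `τ u`; then
`τ` pairs off the other neighbours of `u`, so `u` has odd degree
(`IsVertexInvolution.eq_of_even_degree`). The number of components is even because `J² = -Id` makes
the dimension even, and the dimension is twice the number of vertices minus the number of
components.

Sufficiency. Root each component at its vertex of even degree, if there is one. Counting a root of
odd degree as its own child and setting aside the roots of even degree, every set of siblings has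
even size (`IsParentMap.exists_isSiblingPairing`). Let `J` exchange paired siblings, and the edges
above them, up to sign. Exactly one element per component has no partner: the root of even degree,
or the edge from a root of odd degree to its partner. As the number of components is even, these
leftovers can be exchanged between paired components. Integrability only has to be checked on a
parent and its child (`IsParentMap.nijenhuis_complexStructure_parent`). -/

theorem even_card_of_involution {α : Type*} (S : Finset α) (τ : α → α)
    (hmem : ∀ a ∈ S, τ a ∈ S) (hinv : ∀ a ∈ S, τ (τ a) = a) (hne : ∀ a ∈ S, τ a ≠ a) :
    Even S.card := by
  -- Modulo 2 the size is a sum of ones, and the two ones of each orbit cancel.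
  have h : ∑ _a ∈ S, (1 : ZMod 2) = 0 :=
    Finset.sum_involution (fun a _ => τ a) (fun _ _ => by decide) (fun a ha _ => hne a ha)
      hmem hinv
  simpa [ZMod.natCast_eq_zero_iff_even] using h

/-- A set of even size carries a fixed point free involution `τ` with an orientation `s` of its
orbits. -/
theorem exists_signed_pairing {α : Type*} (S : Finset α) (hS : Even S.card) :
    ∃ (τ : α → α) (s : α → ℝ), ∀ a ∈ S, τ a ∈ S ∧ τ (τ a) = a ∧ s (τ a) = -s a ∧
      (s a = 1 ∨ s a = -1) := by
  classical
  obtain ⟨n, hn⟩ := hS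
  -- The involution flips the Boolean, and the sign reads it off.
  have e : S ≃ Fin n × Bool := Fintype.equivOfCardEq (by simp [hn, mul_two])
  refine ⟨fun a => if h : a ∈ S then e.symm ((e ⟨a, h⟩).1, !(e ⟨a, h⟩).2) else a,
    fun a => if h : a ∈ S then (if (e ⟨a, h⟩).2 then 1 else -1) else 0, fun a ha => ?_⟩
  simp only [ha, dite_true, Subtype.coe_eta, Equiv.apply_symm_apply,
    Bool.not_not, Prod.mk.eta, Equiv.symm_apply_apply]
  cases (e ⟨a, ha⟩).2 <;> simp

/-- A version of `exists_signed_pairing` that preserves the fibres of a map. -/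
theorem exists_signed_pairing_fiberwise {α β : Type*} (S : Finset α) (f : α → β)
    [DecidableEq β] (hS : ∀ b, Even (S.filter (fun a => f a = b)).card) :
    ∃ (τ : α → α) (s : α → ℝ), ∀ a ∈ S, τ a ∈ S ∧ τ (τ a) = a ∧ f (τ a) = f a ∧
      s (τ a) = -s a ∧ (s a = 1 ∨ s a = -1) := by
  choose τ s h using fun b => exists_signed_pairing _ (hS b)
  refine ⟨fun a => τ (f a) a, fun a => s (f a) a, fun a ha => ?_⟩
  obtain ⟨h1, h2, h3, h4⟩ := h (f a) a (by simp [ha])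
  obtain ⟨h5, h6⟩ := Finset.mem_filter.mp h1
  exact ⟨h5, by simpa only [h6] using h2, h6, by simpa only [h6] using h3, h4⟩

/-! ### Brackets and coordinates -/

section

variable {V : Type*}

theorem lie_eq_zero_left [Fintype V] {G : SimpleGraph V} {x : G.LieAlg} (hx : x.1 = 0)
    (y : G.LieAlg) : ⁅x, y⁆ = 0 :=
  Prod.ext rfl (by change G.bracketAux x.1 y.1 = 0; rw [hx, bracketAux_zero_left])

theorem lie_eq_zero_right [Fintype V] {G : SimpleGraph V} {y : G.LieAlg} (hy : y.1 = 0)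
    (x : G.LieAlg) : ⁅x, y⁆ = 0 :=
  Prod.ext rfl (by change G.bracketAux x.1 y.1 = 0; rw [hy, bracketAux_zero_right])

theorem lie_vertexVec_of_not_adj [Fintype V] (G : SimpleGraph V) {v w : V} (h : ¬ G.Adj v w) :
    ⁅G.vertexVec v, G.vertexVec w⁆ = 0 := by
  classical
  refine Prod.ext rfl ?_
  change G.bracketAux (Finsupp.single v 1) (Finsupp.single w 1) = 0
  rw [bracketAux]
  refine Finset.sum_eq_zero fun a _ => Finset.sum_eq_zero fun b _ => ?_
  by_cases ha : v = a
  · by_cases hb : w = b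
    · subst ha hb
      simp [vertexBracket, h]
    · simp [Finsupp.single_apply, hb]
  · simp [Finsupp.single_apply, ha]

theorem edgeVec_symm (G : SimpleGraph V) {v w : V} (h : G.Adj v w) :
    G.edgeVec h.symm = -G.edgeVec h :=
  Prod.ext neg_zero.symm (Subtype.ext (wedge_swap v w))

/-- The linear form on the second exterior power dual to `a ∧ b`. -/
noncomputable def wedgeForm (a b : V) : ⋀[ℝ]^2 (V →₀ ℝ) →ₗ[ℝ] ℝ :=
  exteriorPower.alternatingMapLinearEquiv
    ((Matrix.detRowAlternating (R := ℝ) (n := Fin 2)).compLinearMap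
      (LinearMap.pi ![Finsupp.lapply a, Finsupp.lapply b]))

theorem wedgeForm_wedge [DecidableEq V] (a b v w : V) : wedgeForm a b (wedge v w) =
    (if v = a ∧ w = b then 1 else 0) - (if v = b ∧ w = a then 1 else 0) := by
  rw [wedgeForm, wedge, exteriorPower.alternatingMapLinearEquiv_apply_ιMulti]
  rw [AlternatingMap.compLinearMap_apply]
  refine (Matrix.det_fin_two (Matrix.of fun i => (LinearMap.pi ![Finsupp.lapply a,
    Finsupp.lapply b]) (![Finsupp.single v 1, Finsupp.single w 1] i))).trans ?_
  simp only [Matrix.of_apply, LinearMap.pi_apply, Matrix.cons_val_zero, Matrix.cons_val_one,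
    Finsupp.lapply_apply, Finsupp.single_apply]
  split_ifs <;> simp_all

/-- The coordinate of an element of the Lie algebra of `G` along `a ∧ b`. -/
noncomputable def edgeCoord (G : SimpleGraph V) (a b : V) : G.LieAlg →ₗ[ℝ] ℝ where
  toFun x := wedgeForm a b x.2.1
  map_add' x y := (wedgeForm a b).map_add x.2.1 y.2.1
  map_smul' t x := (wedgeForm a b).map_smul t x.2.1

/-- The coordinate of an element of the Lie algebra of `G` along the vertex `a`. -/
noncomputable def vertexCoord (G : SimpleGraph V) (a : V) : G.LieAlg →ₗ[ℝ] ℝ where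
  toFun x := x.1 a
  map_add' x y := Finsupp.add_apply x.1 y.1 a
  map_smul' t x := Finsupp.smul_apply t x.1 a

@[simp]
theorem edgeCoord_vertexVec (G : SimpleGraph V) (a b v : V) :
    G.edgeCoord a b (G.vertexVec v) = 0 :=
  (wedgeForm a b).map_zero

theorem edgeCoord_edgeVec [DecidableEq V] (G : SimpleGraph V) (a b : V) {v w : V}
    (h : G.Adj v w) : G.edgeCoord a b (G.edgeVec h) =
      (if v = a ∧ w = b then 1 else 0) - (if v = b ∧ w = a then 1 else 0) :=
  wedgeForm_wedge a b v w

theorem edgeCoord_edgeVec_self (G : SimpleGraph V) {v w : V} (h : G.Adj v w) :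
    G.edgeCoord v w (G.edgeVec h) = 1 := by
  classical
  rw [edgeCoord_edgeVec]
  simp [h.ne]

theorem mem_of_edgeCoord_edgeVec_ne_zero (G : SimpleGraph V) {a b v w : V}
    {h : G.Adj v w} (hc : G.edgeCoord a b (G.edgeVec h) ≠ 0) :
    v = a ∧ w = b ∨ v = b ∧ w = a := by
  classical
  rw [edgeCoord_edgeVec] at hc
  by_contra! hcon
  exact hc (by rw [if_neg (fun k => hcon.1 k.1 k.2), if_neg (fun k => hcon.2 k.1 k.2), sub_zero])

theorem vertexCoord_vertexVec [DecidableEq V] (G : SimpleGraph V) (a v : V) :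
    G.vertexCoord a (G.vertexVec v) = if v = a then 1 else 0 :=
  Finsupp.single_apply

@[simp]
theorem vertexCoord_edgeVec (G : SimpleGraph V) (a : V) {v w : V} (h : G.Adj v w) :
    G.vertexCoord a (G.edgeVec h) = 0 :=
  rfl

end

/-! ### Elementary facts on acyclic graphs -/

section

variable {V : Type*} {G : SimpleGraph V}

/-- Two paths of length two with the same ends coincide: a forest has no 4-cycle. -/
theorem IsAcyclic.eq_of_adj_of_adj (hG : G.IsAcyclic) {a b c d : V} (hac : a ≠ c)
    (hab : G.Adj a b) (hbc : G.Adj b c) (had : G.Adj a d) (hdc : G.Adj d c) : b = d := by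
  have h := (hG.subsingleton_path _ _).elim
    (⟨.cons hab (.cons hbc .nil), by simp [hab.ne, hbc.ne, hac]⟩ : G.Path a c)
    ⟨.cons had (.cons hdc .nil), by simp [had.ne, hdc.ne, hac]⟩
  simpa using congrArg (fun p : G.Path a c => p.1.support) h

theorem IsAcyclic.not_adj_of_adj_of_adj (hG : G.IsAcyclic) {a b c : V}
    (hab : G.Adj a b) (hbc : G.Adj b c) : ¬ G.Adj a c := fun hac => by
  have h := (hG.subsingleton_path _ _).elim
    (⟨.cons hab (.cons hbc .nil), by simp [hab.ne, hbc.ne, hac.ne]⟩ : G.Path a c)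
    ⟨.cons hac .nil, by simp [hac.ne]⟩
  simpa using congrArg (fun p : G.Path a c => p.1.length) h

end

end SimpleGraph

namespace SimpleGraph

variable {V : Type*} [Fintype V] {G : SimpleGraph V} {J : G.LieAlg →ₗ[ℝ] G.LieAlg}

/-! ### The permutation of the vertices induced by an adapted complex structure -/

theorem IsAdaptedComplexStructure.exists_eq_smul (hJ : G.IsAdaptedComplexStructure J)
    {x : G.LieAlg} (hx : x ∈ G.vertexEdgeSet) :
    ∃ ε : ℝ, (ε = 1 ∨ ε = -1) ∧ ∃ y ∈ G.vertexEdgeSet, J x = ε • y := by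
  rcases hJ.adapted x hx with h | h
  · exact ⟨1, .inl rfl, _, h, (one_smul ℝ _).symm⟩
  · exact ⟨-1, .inr rfl, _, h, by rw [neg_one_smul, neg_neg]⟩

/-- Fixed points of `τ` can encode the vertices sent to edges, since `J v = ±v` would give `J (J v)
= v`. -/
theorem IsAdaptedComplexStructure.exists_vertex_involution
    (hJ : G.IsAdaptedComplexStructure J) :
    ∃ τ : V → V, (∀ v, τ (τ v) = v) ∧ ∀ v,
      (τ v ≠ v ∧ ∃ ε : ℝ, (ε = 1 ∨ ε = -1) ∧ J (G.vertexVec v) = ε • G.vertexVec (τ v)) ∨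
      (τ v = v ∧ (J (G.vertexVec v)).1 = 0) := by
  classical
  have key : ∀ v, ∃ w,
      (w ≠ v ∧ ∃ ε : ℝ, (ε = 1 ∨ ε = -1) ∧ J (G.vertexVec v) = ε • G.vertexVec w) ∨
      (w = v ∧ (J (G.vertexVec v)).1 = 0) := by
    intro v
    obtain ⟨ε, hε, y, hy, hJy⟩ := hJ.exists_eq_smul (.inl ⟨v, rfl⟩)
    rcases hy with ⟨w, rfl⟩ | ⟨a, b, h, rfl⟩
    · refine ⟨w, .inl ⟨?_, ε, hε, hJy⟩⟩
      rintro rfl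
      have h2 := hJ.isComplexStructure.sq_eq_neg (G.vertexVec w)
      rw [hJy, map_smul, hJy, smul_smul] at h2
      have h3 := congrArg (G.vertexCoord w) h2
      rw [map_smul, map_neg, vertexCoord_vertexVec, if_pos rfl, smul_eq_mul] at h3
      nlinarith
    · refine ⟨v, .inr ⟨rfl, ?_⟩⟩
      rw [hJy]
      exact smul_zero ε
  choose τ hτ using key
  refine ⟨τ, fun v => ?_, hτ⟩
  rcases hτ v with ⟨-, ε, hε, h⟩ | ⟨h, -⟩
  · have h2 := hJ.isComplexStructure.sq_eq_neg (G.vertexVec v)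
    rw [h, map_smul] at h2
    have h3 : ε ≠ 0 := by rcases hε with rfl | rfl <;> norm_num
    have h4 := congrArg (G.vertexCoord v) h2
    rw [map_smul, map_neg, vertexCoord_vertexVec, if_pos rfl, smul_eq_mul] at h4
    rcases hτ (τ v) with ⟨-, ε', hε', h'⟩ | ⟨-, h'⟩
    · rw [h', map_smul, vertexCoord_vertexVec] at h4
      by_contra hne
      rw [if_neg hne, smul_zero, mul_zero] at h4
      norm_num at h4
    · have h5 : G.vertexCoord v (J (G.vertexVec (τ v))) = 0 := by
        change (J (G.vertexVec (τ v))).1 v = 0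
        rw [h']
        rfl
      rw [h5, mul_zero] at h4
      norm_num at h4
  · rw [h, h]

theorem edgeCoord_lie_vertexVec_eq_zero (G : SimpleGraph V) {a b v w : V}
    (h : ¬(v = a ∧ w = b)) (h' : ¬(v = b ∧ w = a)) :
    G.edgeCoord a b ⁅G.vertexVec v, G.vertexVec w⁆ = 0 := by
  by_cases hvw : G.Adj v w
  · rw [lie_vertexVec G hvw]
    by_contra hne
    exact (mem_of_edgeCoord_edgeVec_ne_zero G hne).elim h h'
  · rw [lie_vertexVec_of_not_adj G hvw, map_zero]

/-- Otherwise both mixed brackets vanish and `⁅J v, J u⁆` has no `v ∧ u` component, so nothing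
cancels `⁅v, u⁆` in the Nijenhuis tensor. -/
theorem IsAdaptedComplexStructure.adj_or_adj (hJ : G.IsAdaptedComplexStructure J) {τ : V → V}
    (hτ : ∀ v, (τ v ≠ v ∧ ∃ ε : ℝ, (ε = 1 ∨ ε = -1) ∧ J (G.vertexVec v) = ε • G.vertexVec (τ v)) ∨
      (τ v = v ∧ (J (G.vertexVec v)).1 = 0))
    {v u : V} (hvu : G.Adj v u) (hne : u ≠ τ v) :
    (τ u ≠ u ∧ G.Adj v (τ u)) ∨ (τ v ≠ v ∧ G.Adj u (τ v)) := by
  by_contra! hcon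
  have h1 : ⁅J (G.vertexVec v), G.vertexVec u⁆ = 0 := by
    rcases hτ v with ⟨hv, ε, -, h⟩ | ⟨-, h⟩
    · rw [h, smul_lie, lie_vertexVec_of_not_adj G fun k => hcon.2 hv k.symm, smul_zero]
    · exact lie_eq_zero_left h _
  have h2 : ⁅G.vertexVec v, J (G.vertexVec u)⁆ = 0 := by
    rcases hτ u with ⟨hu, ε, -, h⟩ | ⟨-, h⟩
    · rw [h, lie_smul, lie_vertexVec_of_not_adj G (hcon.1 hu), smul_zero]
    · exact lie_eq_zero_right h _
  have h3 : G.edgeCoord v u ⁅J (G.vertexVec v), J (G.vertexVec u)⁆ = 0 := by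
    rcases hτ v with ⟨hv, ε, -, h⟩ | ⟨-, h⟩
    · rcases hτ u with ⟨hu, ε', -, h'⟩ | ⟨-, h'⟩
      · rw [h, h', lie_smul, smul_lie, map_smul, map_smul,
          edgeCoord_lie_vertexVec_eq_zero G (fun k => hv k.1) (fun k => hne k.1.symm),
          smul_zero, smul_zero]
      · rw [lie_eq_zero_right h', map_zero]
    · rw [lie_eq_zero_left h, map_zero]
  have h4 := congrArg (G.edgeCoord v u)
    (hJ.isComplexStructure.nijenhuis_eq_zero (G.vertexVec v) (G.vertexVec u))
  rw [h1, h2, add_zero, map_zero, add_zero, map_sub, h3, lie_vertexVec G hvu,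
    edgeCoord_edgeVec_self, map_zero] at h4
  norm_num at h4

/-- Otherwise acyclicity kills `⁅J v, J x⁆`, and applying `J` to the Nijenhuis identity writes `J
⁅v, x⁆` as a combination of two distinct edges with nonzero coefficients. An adapted `J` sends the
edge `⁅v, x⁆` to a single vertex or edge up to sign. -/
theorem IsAdaptedComplexStructure.not_adj_of_adj (hJ : G.IsAdaptedComplexStructure J) {τ : V → V}
    (hτ : ∀ v, (τ v ≠ v ∧ ∃ ε : ℝ, (ε = 1 ∨ ε = -1) ∧ J (G.vertexVec v) = ε • G.vertexVec (τ v)) ∨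
      (τ v = v ∧ (J (G.vertexVec v)).1 = 0)) (hG : G.IsAcyclic)
    {v x : V} (hxv : G.Adj x v) (hxτ : G.Adj x (τ v)) (hv : τ v ≠ v) (hx : τ x ≠ x) :
    ¬ G.Adj v (τ x) := by
  classical
  intro hvx
  have hnot : ¬ G.Adj (τ v) (τ x) := fun k =>
    hx (hG.eq_of_adj_of_adj hv hxτ.symm hxv k hvx.symm).symm
  obtain ⟨-, ε, hε, h⟩ := (hτ v).resolve_right fun k => hv k.1
  obtain ⟨-, δ, hδ, h'⟩ := (hτ x).resolve_right fun k => hx k.1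
  have h4 := hJ.isComplexStructure.nijenhuis_eq_zero (G.vertexVec v) (G.vertexVec x)
  rw [h, h', lie_smul, smul_lie, smul_lie, lie_smul, lie_vertexVec_of_not_adj G hnot,
    lie_vertexVec G hxv.symm, lie_vertexVec G hxτ.symm, lie_vertexVec G hvx, smul_zero, smul_zero,
    sub_zero] at h4
  have h5 := congrArg J h4
  rw [map_add, hJ.isComplexStructure.sq_eq_neg, map_zero, add_neg_eq_zero] at h5
  obtain ⟨η, hη, y, hy, hJy⟩ := hJ.exists_eq_smul (.inr ⟨_, _, hxv.symm, rfl⟩)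
  rw [hJy] at h5
  have hε0 : ε ≠ 0 := by rcases hε with rfl | rfl <;> norm_num
  have hδ0 : δ ≠ 0 := by rcases hδ with rfl | rfl <;> norm_num
  have e1 := congrArg (G.edgeCoord (τ v) x) h5
  have e2 := congrArg (G.edgeCoord v (τ x)) h5
  have c1 : G.edgeCoord (τ v) x (G.edgeVec hvx) = 0 := by
    by_contra hne
    rcases mem_of_edgeCoord_edgeVec_ne_zero G hne with k | k
    · exact hv k.1.symm
    · exact hxv.ne k.1.symm
  have c2 : G.edgeCoord v (τ x) (G.edgeVec hxτ.symm) = 0 := by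
    by_contra hne
    rcases mem_of_edgeCoord_edgeVec_ne_zero G hne with k | k
    · exact hv k.1
    · exact hxv.ne k.2
  simp only [map_add, map_smul, edgeCoord_edgeVec_self, c1, c2, smul_eq_mul, mul_one, mul_zero,
    add_zero, zero_add] at e1 e2
  rcases hy with ⟨w, rfl⟩ | ⟨a, b, hab, rfl⟩
  · simp only [edgeCoord_vertexVec, mul_zero] at e1
    exact hε0 e1.symm
  · have k1 := mem_of_edgeCoord_edgeVec_ne_zero G (a := τ v) (b := x) (h := hab)
      (fun k => hε0 (by rw [← e1, k, mul_zero]))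
    have k2 := mem_of_edgeCoord_edgeVec_ne_zero G (a := v) (b := τ x) (h := hab)
      (fun k => hδ0 (by rw [← e2, k, mul_zero]))
    grind [hxv.ne]

/-! ### Parity of degrees -/

/-- The combinatorial trace of an adapted complex structure on a graph: an involution of the
vertices, fixing the vertices that are sent to edges. -/
structure IsVertexInvolution (G : SimpleGraph V) (τ : V → V) : Prop where
  inv : ∀ v, τ (τ v) = v
  adj_or_adj : ∀ v u, G.Adj v u → u ≠ τ v →
    (τ u ≠ u ∧ G.Adj v (τ u)) ∨ (τ v ≠ v ∧ G.Adj u (τ v))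
  not_adj_of_adj : ∀ v x, G.Adj x v → G.Adj x (τ v) → τ v ≠ v → τ x ≠ x → ¬ G.Adj v (τ x)

theorem IsAdaptedComplexStructure.exists_isVertexInvolution
    (hJ : G.IsAdaptedComplexStructure J) (hG : G.IsAcyclic) :
    ∃ τ : V → V, G.IsVertexInvolution τ := by
  obtain ⟨τ, hinv, hτ⟩ := hJ.exists_vertex_involution
  exact ⟨τ, hinv, fun v u h h' => hJ.adj_or_adj hτ h h',
    fun v x h1 h2 h3 h4 => hJ.not_adj_of_adj hτ hG h1 h2 h3 h4⟩

namespace IsVertexInvolution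

variable {τ : V → V}

/-- The neighbours of `v` other than `x` are paired by `τ`: the other alternative of `adj_or_adj`
would close a 4-cycle, and `not_adj_of_adj` prevents `x` from being a partner. -/
theorem not_even_degree_of_adj_of_adj [DecidableRel G.Adj] (hτ : G.IsVertexInvolution τ)
    (hG : G.IsAcyclic) {v x : V} (hxv : G.Adj x v) (hxτ : G.Adj x (τ v)) (hv : τ v ≠ v) :
    ¬ Even (G.degree v) := by
  classical
  have hmem : x ∈ G.neighborFinset v := by simpa using hxv.symm
  have hpair : ∀ u ∈ (G.neighborFinset v).erase x, τ u ≠ u ∧ G.Adj v (τ u) := by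
    intro u hu
    rw [Finset.mem_erase, mem_neighborFinset] at hu
    have hu1 : u ≠ τ v := by
      rintro rfl
      exact hG.not_adj_of_adj_of_adj hxv hu.2 hxτ
    refine (hτ.adj_or_adj v u hu.2 hu1).resolve_right fun h => ?_
    exact hu.1 (hG.eq_of_adj_of_adj hv.symm hu.2 h.2 hxv.symm hxτ)
  have key : Even ((G.neighborFinset v).erase x).card := by
    refine even_card_of_involution _ τ (fun u hu => ?_) (fun a _ => hτ.inv a)
      (fun u hu => (hpair u hu).1)
    rw [Finset.mem_erase, mem_neighborFinset]
    refine ⟨?_, (hpair u hu).2⟩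
    rintro rfl
    have h := hτ.not_adj_of_adj v (τ u) hxv hxτ hv
    rw [hτ.inv] at h
    exact h (hpair u hu).1.symm (by simpa using Finset.mem_of_mem_erase hu)
  rw [← card_neighborFinset_eq_degree, ← Finset.card_erase_add_one hmem, Nat.not_even_iff_odd]
  exact key.add_one

/-- Here `τ` pairs the neighbours of `v` other than `τ v`, as the other alternative of `adj_or_adj`
would close a triangle. -/
theorem not_even_degree_of_adj [DecidableRel G.Adj] (hτ : G.IsVertexInvolution τ)
    (hG : G.IsAcyclic) {v : V} (hv : G.Adj v (τ v)) : ¬ Even (G.degree v) := by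
  classical
  have hmem : τ v ∈ G.neighborFinset v := by simpa using hv
  have hpair : ∀ u ∈ (G.neighborFinset v).erase (τ v), τ u ≠ u ∧ G.Adj v (τ u) := by
    intro u hu
    rw [Finset.mem_erase, mem_neighborFinset] at hu
    refine (hτ.adj_or_adj v u hu.2 hu.1).resolve_right fun h => ?_
    exact hG.not_adj_of_adj_of_adj hu.2 h.2 hv
  have key : Even ((G.neighborFinset v).erase (τ v)).card := by
    refine even_card_of_involution _ τ (fun u hu => ?_) (fun a _ => hτ.inv a)
      (fun u hu => (hpair u hu).1)
    rw [Finset.mem_erase, mem_neighborFinset]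
    refine ⟨fun h => ?_, (hpair u hu).2⟩
    have huv : u = v := by rw [← hτ.inv u, h, hτ.inv]
    subst huv
    simp at hu
  rw [← card_neighborFinset_eq_degree, ← Finset.card_erase_add_one hmem, Nat.not_even_iff_odd]
  exact key.add_one

/-- Walking away from a pair of vertices with a common neighbour, one only meets vertices of odd
degree. -/
theorem not_even_degree_of_isPath [DecidableRel G.Adj] (hτ : G.IsVertexInvolution τ)
    (hG : G.IsAcyclic) {u w : V} (p : G.Walk u w) (hp : p.IsPath) {x : V} (hxu : G.Adj x u)
    (hxτ : G.Adj x (τ u)) (hu : τ u ≠ u) (hx : x ∉ p.support) : ¬ Even (G.degree w) := by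
  induction p generalizing x with
  | nil => exact hτ.not_even_degree_of_adj_of_adj hG hxu hxτ hu
  | @cons u u₂ w h p ih =>
    rw [Walk.cons_isPath_iff] at hp
    rw [Walk.support_cons, List.mem_cons, not_or] at hx
    have hne : u₂ ≠ τ u := by
      rintro rfl
      exact hG.not_adj_of_adj_of_adj hxu h hxτ
    -- Either `u` becomes the common neighbour of `u₂` and `τ u₂`, and the induction continues, or a
    -- 4-cycle forces the path back to `x`.
    rcases hτ.adj_or_adj u u₂ h hne with h' | h'
    · exact ih hp.1 h h'.2 h'.1 hp.2
    · have := hG.eq_of_adj_of_adj hu.symm h h'.2 hxu.symm hxτ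
      exact absurd (this ▸ p.start_mem_support) hx.2

theorem eq_of_even_degree [DecidableRel G.Adj] (hτ : G.IsVertexInvolution τ)
    (hG : G.IsAcyclic) {v w : V} (hvw : G.Reachable v w) (hv : Even (G.degree v))
    (hw : Even (G.degree w)) : v = w := by
  obtain ⟨p, hp⟩ := hvw.exists_isPath
  cases p with
  | nil => rfl
  | @cons _ u _ h p =>
    rw [Walk.cons_isPath_iff] at hp
    have hne : u ≠ τ v := by
      rintro rfl
      exact hτ.not_even_degree_of_adj hG h hv
    rcases hτ.adj_or_adj v u h hne with h' | h'
    · exact absurd hw (hτ.not_even_degree_of_isPath hG p hp.1 h h'.2 h'.1 hp.2)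
    · exact absurd hv (hτ.not_even_degree_of_adj_of_adj hG h.symm h'.2 h'.1)

end IsVertexInvolution

theorem AdmitsAdaptedComplexStructure.ncard_even_degree_le_one [DecidableRel G.Adj]
    (h : G.AdmitsAdaptedComplexStructure) (hG : G.IsAcyclic) (c : G.ConnectedComponent) :
    {v : V | v ∈ c.supp ∧ Even (G.degree v)}.ncard ≤ 1 := by
  obtain ⟨J, hJ⟩ := h
  obtain ⟨τ, hτ⟩ := hJ.exists_isVertexInvolution hG
  rw [Set.ncard_le_one]
  rintro v ⟨hv, hv'⟩ w ⟨hw, hw'⟩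
  exact hτ.eq_of_even_degree hG (ConnectedComponent.exact (hv.trans hw.symm)) hv' hw'

/-! ### Parity of the dimension -/

/-- The square of `det J` is `(-1) ^ dim`, which is negative in odd dimension. -/
theorem _root_.IsComplexStructure.even_finrank {L : Type*} [LieRing L] [LieAlgebra ℝ L]
    [Module.Finite ℝ L] {J : L →ₗ[ℝ] L} (hJ : IsComplexStructure J) :
    Even (Module.finrank ℝ L) := by
  have h : J * J = (-1 : ℝ) • (1 : L →ₗ[ℝ] L) := by
    ext x
    simpa using hJ.sq_eq_neg x
  have h2 := congrArg LinearMap.det h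
  rw [map_mul, LinearMap.det_smul, map_one, mul_one] at h2
  by_contra hodd
  rw [(Nat.not_even_iff_odd.mp hodd).neg_one_pow] at h2
  nlinarith [mul_self_nonneg (LinearMap.det J)]

end SimpleGraph

namespace SimpleGraph

variable {V : Type*} {G : SimpleGraph V}

/-! ### Rooted forests -/

/-- `p` is the parent map of the forest `G`, with one root `r c` for each component `c`. Roots are
their own parents. -/
structure IsParentMap (G : SimpleGraph V) (r : G.ConnectedComponent → V) (p : V → V) : Prop where
  mk_root : ∀ c, G.connectedComponentMk (r c) = c
  eq_self_iff : ∀ v, p v = v ↔ v = r (G.connectedComponentMk v)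
  adj : ∀ v, p v ≠ v → G.Adj (p v) v
  eq_or_eq : ∀ v u, G.Adj v u → p u = v ∨ p v = u
  antisymm : ∀ v u, p u = v → p v = u → u = v

/-- Prepending the edge to the path from `v` gives the path from `u`, unless the former already
passes through `u`. The ends `r`, `r'` are separate variables because the roots of the components of
`v` and `u` are only propositionally equal. -/
theorem IsAcyclic.snd_eq_or_snd_eq (hG : G.IsAcyclic) {v u r r' : V} (hr : r = r')
    {q : G.Walk v r} {q' : G.Walk u r'} (hq : q.IsPath) (hq' : q'.IsPath) (h : G.Adj v u) :
    q'.snd = v ∨ q.snd = u := by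
  subst hr
  by_cases hu : u ∈ q.support
  · exact .inr (hG.eq_snd_of_adj_start hq h hu).symm
  · left
    have := (hG.subsingleton_path u r).elim ⟨q', hq'⟩ ⟨.cons h.symm q, hq.cons hu⟩
    rw [Subtype.mk.inj this]
    simp

theorem IsAcyclic.length_eq_of_snd_eq (hG : G.IsAcyclic) {v u r r' : V} (hr : r = r')
    {q : G.Walk v r} {q' : G.Walk u r'} (hq : q.IsPath) (hq' : q'.IsPath) (h : q.snd = u)
    (hne : u ≠ v) : q.length = q'.length + 1 := by
  subst hr h
  have hnil : ¬ q.Nil := fun k => hne (by cases k; rfl)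
  have := (hG.subsingleton_path q.snd r).elim ⟨q', hq'⟩ ⟨q.tail, hq.tail⟩
  rw [Subtype.mk.inj this, Walk.length_tail_add_one hnil]

/-- The parent is the second vertex of the path to the root; on the trivial path `snd` returns the
root itself. Distinct vertices cannot be each other's parent, since each would be farther from the
root than the other. -/
theorem IsAcyclic.exists_isParentMap (hG : G.IsAcyclic) (r : G.ConnectedComponent → V)
    (hr : ∀ c, G.connectedComponentMk (r c) = c) : ∃ p : V → V, G.IsParentMap r p := by
  have hex : ∀ v, ∃ q : G.Walk v (r (G.connectedComponentMk v)), q.IsPath := fun v =>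
    (ConnectedComponent.exact (hr (G.connectedComponentMk v)).symm).exists_isPath
  choose q hq using hex
  have hadj : ∀ v, (q v).snd ≠ v → G.Adj (q v).snd v := fun v hv =>
    (Walk.adj_snd fun k => hv (by rw [Walk.snd, Walk.getVert_of_length_le _
      (by rw [Walk.length_eq_zero_iff.mpr k]; exact Nat.zero_le _), ← k.eq])).symm
  refine ⟨fun v => (q v).snd, hr, fun v => ⟨fun h => ?_, fun h => ?_⟩, hadj, fun v u h => ?_,
    fun v u h1 h2 => ?_⟩
  · by_contra hne
    have hnil : ¬ (q v).Nil := fun k => hne k.eq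
    exact (Walk.adj_snd hnil).ne h.symm
  · have : ∀ w (q' : G.Walk v w), q'.IsPath → v = w → q'.snd = v := by
      rintro w q' hq' rfl
      rw [Walk.isPath_iff_nil.mp hq' |>.eq_nil]
      rfl
    exact this _ (q v) (hq v) h
  · exact hG.snd_eq_or_snd_eq (congrArg r (ConnectedComponent.sound h.reachable)) (hq v) (hq u) h
  · by_contra hne
    have hvu : G.connectedComponentMk v = G.connectedComponentMk u := by
      refine ConnectedComponent.sound (Adj.reachable ?_)
      have := hadj u (by rw [h1]; exact Ne.symm hne)
      rwa [h1] at this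
    have l1 := hG.length_eq_of_snd_eq (congrArg r hvu) (hq v) (hq u) h2 hne
    have l2 := hG.length_eq_of_snd_eq (congrArg r hvu.symm) (hq u) (hq v) h1 (Ne.symm hne)
    omega

/-! ### A basis of the Lie algebra of a forest -/

/-- The Lie algebra of `G` is spanned by the vertices and the edges. -/
theorem LieAlg.eq_top_of_mem (S : Submodule ℝ G.LieAlg) (hv : ∀ v, G.vertexVec v ∈ S)
    (he : ∀ v w (h : G.Adj v w), G.edgeVec h ∈ S) : S = ⊤ := by
  have h1 : ∀ x : V →₀ ℝ, ((x, 0) : G.LieAlg) ∈ S := by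
    intro x
    induction x using Finsupp.induction_linear with
    | zero => exact S.zero_mem
    | add x y hx hy =>
      have e : ((x + y, 0) : G.LieAlg) = (x, 0) + (y, 0) := Prod.ext rfl (add_zero 0).symm
      exact e ▸ S.add_mem hx hy
    | single a t =>
      have e : ((Finsupp.single a t, 0) : G.LieAlg) = t • G.vertexVec a :=
        Prod.ext (Finsupp.smul_single_one a t).symm (smul_zero t).symm
      exact e ▸ S.smul_mem t (hv a)
  have h2 : ∀ z (hz : z ∈ G.edgeSpace), ((0, ⟨z, hz⟩) : G.LieAlg) ∈ S := by
    intro z hz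
    induction hz using Submodule.span_induction with
    | mem z hz =>
      obtain ⟨v, w, h, rfl⟩ := hz
      exact he v w h
    | zero => exact S.zero_mem
    | add x y hx hy hx' hy' =>
      have e : ((0, ⟨x + y, add_mem hx hy⟩) : G.LieAlg) = (0, ⟨x, hx⟩) + (0, ⟨y, hy⟩) :=
        Prod.ext (add_zero 0).symm rfl
      exact e ▸ S.add_mem hx' hy'
    | smul t x hx hx' =>
      have e : ((0, ⟨t • x, Submodule.smul_mem _ t hx⟩) : G.LieAlg) = t • (0, ⟨x, hx⟩) :=
        Prod.ext (smul_zero t).symm rfl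
      exact e ▸ S.smul_mem t hx'
  refine eq_top_iff.mpr fun x _ => ?_
  have e : x = (x.1, 0) + (0, x.2) := Prod.ext (add_zero _).symm (zero_add _).symm
  exact e ▸ S.add_mem (h1 x.1) (h2 x.2.1 x.2.2)

namespace IsParentMap

variable {r : G.ConnectedComponent → V} {p : V → V}

/-- The vertices, and the edges oriented from the parent to the child. -/
noncomputable def vec (hp : G.IsParentMap r p) : V ⊕ {u // p u ≠ u} → G.LieAlg :=
  Sum.elim G.vertexVec fun u => G.edgeVec (hp.adj u u.2)

theorem linearIndependent_vec (hp : G.IsParentMap r p) : LinearIndependent ℝ hp.vec := by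
  classical
  let D : V ⊕ {u // p u ≠ u} → G.LieAlg →ₗ[ℝ] ℝ :=
    Sum.elim G.vertexCoord fun u => G.edgeCoord (p u) u
  have key : ∀ i j, (D i)
      (hp.vec j) = if j = i then 1 else 0 := by
    rintro (v | u) (w | t)
    · simp [D, vec, vertexCoord_vertexVec]
    · simp [D, vec]
    · simp [D, vec]
    · simp only [D, vec, Sum.elim_inr, edgeCoord_edgeVec, Sum.inr.injEq, Subtype.ext_iff]
      -- The term for the reversed orientation vanishes, as no two distinct vertices are each
      -- other's parent.
      have h : ¬(p t = u ∧ (t : V) = p u) := fun h =>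
        u.2 (h.2.symm.trans (hp.antisymm _ _ h.1 h.2.symm))
      rw [if_neg h, sub_zero]
      have h' : (p t = p u ∧ (t : V) = u) ↔ (t : V) = u := and_iff_right_of_imp fun k => by rw [k]
      simp only [h']
  rw [linearIndependent_iff']
  intro s g hg i hi
  have h := congrArg (D i) hg
  rw [map_sum, map_zero, Finset.sum_eq_single i] at h
  · simpa [key] using h
  · intro j _ hj
    rw [map_smul, key, if_neg hj, smul_zero]
  · exact fun k => absurd hi k

/-- The basis of the Lie algebra of a rooted forest given by the vertices and the edges. -/
noncomputable def basis (hp : G.IsParentMap r p) :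
    Module.Basis (V ⊕ {u // p u ≠ u}) ℝ G.LieAlg :=
  Module.Basis.mk hp.linearIndependent_vec <| by
    refine (LieAlg.eq_top_of_mem (Submodule.span ℝ (Set.range hp.vec)) (fun v => Submodule.subset_span ⟨.inl v, rfl⟩)
      fun v w h => ?_).ge
    rcases hp.eq_or_eq v w h with k | k
    · subst k
      exact Submodule.subset_span ⟨.inr ⟨w, h.ne⟩, rfl⟩
    · subst k
      rw [edgeVec_symm G h.symm]
      exact Submodule.neg_mem _ (Submodule.subset_span ⟨.inr ⟨v, h.ne'⟩, rfl⟩)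

theorem basis_inl (hp : G.IsParentMap r p) (v : V) : hp.basis (.inl v) = G.vertexVec v := by
  rw [basis, Module.Basis.mk_apply, vec, Sum.elim_inl]

theorem basis_inr (hp : G.IsParentMap r p) (u : {u // p u ≠ u}) :
    hp.basis (.inr u) = G.edgeVec (hp.adj u u.2) := by
  rw [basis, Module.Basis.mk_apply, vec, Sum.elim_inr]

/-- Edges correspond to non-roots, and roots to components. -/
theorem finrank_add_card [Fintype V] (hp : G.IsParentMap r p) :
    Module.finrank ℝ G.LieAlg + Nat.card G.ConnectedComponent = 2 * Fintype.card V := by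
  classical
  have e : {u // p u = u} ≃ G.ConnectedComponent :=
    { toFun u := G.connectedComponentMk u
      invFun c := ⟨r c, (hp.eq_self_iff _).mpr (by rw [hp.mk_root])⟩
      left_inv u := Subtype.ext ((hp.eq_self_iff _).mp u.2).symm
      right_inv c := hp.mk_root c }
  rw [Module.finrank_eq_card_basis hp.basis, ← Nat.card_congr e, Nat.card_eq_fintype_card,
    Fintype.card_sum, Fintype.card_subtype_compl, add_assoc,
    Nat.sub_add_cancel (Fintype.card_subtype_le _), two_mul]

end IsParentMap

theorem AdmitsAdaptedComplexStructure.even_card_connectedComponent [Fintype V]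
    (h : G.AdmitsAdaptedComplexStructure) (hG : G.IsAcyclic) :
    Even (Nat.card G.ConnectedComponent) := by
  obtain ⟨J, hJ⟩ := h
  -- Any choice of roots serves for counting dimensions.
  obtain ⟨p, hp⟩ := hG.exists_isParentMap Quot.out fun c => c.out_eq
  have : Module.Finite ℝ G.LieAlg := .of_basis hp.basis
  have h1 := hJ.isComplexStructure.even_finrank
  have h2 := hp.finrank_add_card
  rw [Nat.even_iff] at h1 ⊢
  omega

end SimpleGraph

/-! ### The Nijenhuis tensor -/

section

variable {L : Type*} [LieRing L] [LieAlgebra ℝ L]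

/-- The Nijenhuis tensor as a bilinear map. -/
noncomputable def nijenhuis (J : L →ₗ[ℝ] L) : L →ₗ[ℝ] L →ₗ[ℝ] L :=
  LinearMap.mk₂ ℝ (fun x y => ⁅x, y⁆ + J (⁅J x, y⁆ + ⁅x, J y⁆) - ⁅J x, J y⁆)
    (fun x x' y => by simp only [map_add, add_lie]; abel)
    (fun t x y => by simp only [map_add, map_smul, smul_lie, smul_add, smul_sub])
    (fun x y y' => by simp only [map_add, lie_add]; abel)
    (fun t x y => by simp only [map_add, map_smul, lie_smul, smul_add, smul_sub])

theorem nijenhuis_apply (J : L →ₗ[ℝ] L) (x y : L) :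
    nijenhuis J x y = ⁅x, y⁆ + J (⁅J x, y⁆ + ⁅x, J y⁆) - ⁅J x, J y⁆ :=
  rfl

theorem nijenhuis_swap (J : L →ₗ[ℝ] L) (x y : L) : nijenhuis J y x = -nijenhuis J x y := by
  rw [nijenhuis_apply, nijenhuis_apply, ← lie_skew y x, ← lie_skew (J y) x, ← lie_skew y (J x),
    ← lie_skew (J y) (J x)]
  simp only [map_add, map_neg]
  abel

/-- This conjugate linearity lets either argument be replaced by its image under `J` when testing
for zero. -/
theorem nijenhuis_map_left {J : L →ₗ[ℝ] L} (hJ : ∀ x, J (J x) = -x) (x y : L) :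
    nijenhuis J (J x) y = -J (nijenhuis J x y) := by
  simp only [nijenhuis_apply, hJ, map_add, map_sub, neg_lie, map_neg]
  abel

theorem nijenhuis_eq_zero_of_left {J : L →ₗ[ℝ] L} (hJ : ∀ x, J (J x) = -x) {x y : L}
    (h : nijenhuis J (J x) y = 0) : nijenhuis J x y = 0 := by
  have h2 := congrArg J h
  rwa [nijenhuis_map_left hJ, map_neg, hJ, neg_neg, map_zero] at h2

theorem nijenhuis_eq_zero_of_right {J : L →ₗ[ℝ] L} (hJ : ∀ x, J (J x) = -x) {x y : L}
    (h : nijenhuis J x (J y) = 0) : nijenhuis J x y = 0 := by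
  rw [nijenhuis_swap, neg_eq_zero] at h ⊢
  exact nijenhuis_eq_zero_of_left hJ h

end

namespace SimpleGraph

variable {V : Type*} {G : SimpleGraph V}

/-- For an almost complex structure that permutes the vertices and edges up to sign, the Nijenhuis
tensor only needs to be computed on pairs of adjacent vertices. -/
theorem isComplexStructure_of_adj [Fintype V] {J : G.LieAlg →ₗ[ℝ] G.LieAlg}
    (hJ : ∀ x, J (J x) = -x)
    (had : ∀ x ∈ G.vertexEdgeSet, J x ∈ G.vertexEdgeSet ∨ -J x ∈ G.vertexEdgeSet)
    (hN : ∀ v u, G.Adj v u → nijenhuis J (G.vertexVec v) (G.vertexVec u) = 0) :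
    IsComplexStructure J := by
  have h1 : ∀ x ∈ G.vertexEdgeSet, ∀ y ∈ G.vertexEdgeSet, ⁅x, y⁆ ≠ 0 → nijenhuis J x y = 0 := by
    rintro _ (⟨v, rfl⟩ | ⟨v, w, h, rfl⟩) _ (⟨u, rfl⟩ | ⟨u, t, h', rfl⟩) hxy
    · exact hN v u (by_contra fun h => hxy (lie_vertexVec_of_not_adj G h))
    · exact absurd (lie_eq_zero_right rfl _) hxy
    · exact absurd (lie_eq_zero_left rfl _) hxy
    · exact absurd (lie_eq_zero_left rfl _) hxy
  have hsm : ∀ x ∈ G.vertexEdgeSet, ∃ (ε : ℝ) (y : G.LieAlg), y ∈ G.vertexEdgeSet ∧ J x = ε • y := by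
    intro x hx
    rcases had x hx with h | h
    · exact ⟨1, _, h, (one_smul ℝ _).symm⟩
    · exact ⟨-1, _, h, by rw [neg_one_smul, neg_neg]⟩
  have h2 : ∀ x ∈ G.vertexEdgeSet, ∀ y ∈ G.vertexEdgeSet, nijenhuis J x y = 0 := by
    intro x hx y hy
    -- If one of the four brackets in the tensor is nonzero, conjugate linearity moves the question
    -- to that pair, where `h1` applies; if all four vanish, so does the tensor.
    by_contra hne
    obtain ⟨ε, x', hx', ex⟩ := hsm x hx
    obtain ⟨δ, y', hy', ey⟩ := hsm y hy
    have b1 : ⁅x, y⁆ = 0 := by_contra fun h => hne (h1 x hx y hy h)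
    have b2 : ⁅J x, y⁆ = 0 := by_contra fun h => hne <| nijenhuis_eq_zero_of_left hJ <| by
      rw [ex, smul_lie] at h
      rw [ex, map_smul, LinearMap.smul_apply, h1 x' hx' y hy (fun k => h (by rw [k, smul_zero])),
        smul_zero]
    have b3 : ⁅x, J y⁆ = 0 := by_contra fun h => hne <| nijenhuis_eq_zero_of_right hJ <| by
      rw [ey, lie_smul] at h
      rw [ey, map_smul, h1 x hx y' hy' (fun k => h (by rw [k, smul_zero])), smul_zero]
    have b4 : ⁅J x, J y⁆ = 0 := by_contra fun h => hne <| nijenhuis_eq_zero_of_left hJ <|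
      nijenhuis_eq_zero_of_right hJ <| by
      rw [ex, ey, lie_smul, smul_lie] at h
      rw [ex, ey, map_smul, map_smul, LinearMap.smul_apply,
        h1 x' hx' y' hy' (fun k => h (by rw [k, smul_zero, smul_zero])), smul_zero, smul_zero]
    exact hne (by rw [nijenhuis_apply, b1, b2, b3, b4, add_zero, map_zero, add_zero, sub_zero])
  have h3 : ∀ x ∈ G.vertexEdgeSet, nijenhuis J x = 0 := fun x hx =>
    LinearMap.ker_eq_top.mp <| LieAlg.eq_top_of_mem _ (fun v => h2 x hx _ (.inl ⟨v, rfl⟩))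
      fun v w h => h2 x hx _ (.inr ⟨v, w, h, rfl⟩)
  have h4 : nijenhuis J = 0 :=
    LinearMap.ker_eq_top.mp <| LieAlg.eq_top_of_mem _ (fun v => h3 _ (.inl ⟨v, rfl⟩))
      fun v w h => h3 _ (.inr ⟨v, w, h, rfl⟩)
  exact ⟨hJ, fun x y => by rw [← nijenhuis_apply, h4]; rfl⟩

/-! ### Pairing siblings in a rooted forest -/

/-- A pairing `τ`, oriented by the sign `s`, of the vertices outside a set `E` of roots, such that
the vertices of each pair have the same parent. -/
structure IsSiblingPairing (p : V → V) (E : Set V) (τ : V → V) (s : V → ℝ) : Prop where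
  root : ∀ u ∈ E, p u = u
  notMem : ∀ u ∉ E, τ u ∉ E
  inv : ∀ u ∉ E, τ (τ u) = u
  parent : ∀ u ∉ E, p (τ u) = p u
  sign_neg : ∀ u ∉ E, s (τ u) = -s u
  sign : ∀ u ∉ E, s u = 1 ∨ s u = -1

namespace IsSiblingPairing

variable {p : V → V} {E : Set V} {τ : V → V} {s : V → ℝ}

theorem ne (hτ : IsSiblingPairing p E τ s) {u : V} (hu : u ∉ E) : τ u ≠ u := fun h => by
  have h1 := hτ.sign_neg u hu
  rw [h] at h1
  rcases hτ.sign u hu with h2 | h2 <;> rw [h2] at h1 <;> norm_num at h1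

theorem notMem_of_ne (hτ : IsSiblingPairing p E τ s) {u : V} (hu : p u ≠ u) : u ∉ E :=
  fun h => hu (hτ.root u h)

theorem parent_ne_of_root (hτ : IsSiblingPairing p E τ s) {u : V} (hu : u ∉ E) (h : p u = u) :
    p (τ u) ≠ τ u := by
  rw [hτ.parent u hu, h]
  exact (hτ.ne hu).symm

theorem sign_mul_sign (hτ : IsSiblingPairing p E τ s) {u : V} (hu : u ∉ E) :
    s u * s (τ u) = -1 := by
  rw [hτ.sign_neg u hu]
  rcases hτ.sign u hu with h | h <;> rw [h] <;> norm_num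

end IsSiblingPairing

theorem IsParentMap.neighborFinset_eq_of_root [Fintype V] [DecidableEq V] [DecidableRel G.Adj]
    {r : G.ConnectedComponent → V} {p : V → V} (hp : G.IsParentMap r p) {v : V} (hv : p v = v) :
    G.neighborFinset v = ({u | p u = v} : Finset V).erase v := by
  ext u
  simp only [mem_neighborFinset, Finset.mem_erase, Finset.mem_filter, Finset.mem_univ, true_and]
  refine ⟨fun h => ⟨h.ne', ?_⟩, fun ⟨h1, h2⟩ => ?_⟩
  · exact (hp.eq_or_eq v u h).resolve_right fun k => h.ne (hv.symm.trans k)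
  · subst h2
    exact hp.adj u h1.symm

theorem IsParentMap.neighborFinset_eq_of_not_root [Fintype V] [DecidableEq V] [DecidableRel G.Adj]
    {r : G.ConnectedComponent → V} {p : V → V} (hp : G.IsParentMap r p) {v : V} (hv : p v ≠ v) :
    G.neighborFinset v = insert (p v) ({u | p u = v} : Finset V) := by
  ext u
  simp only [mem_neighborFinset, Finset.mem_insert, Finset.mem_filter, Finset.mem_univ, true_and]
  refine ⟨fun h => (hp.eq_or_eq v u h).symm.imp_left Eq.symm, ?_⟩
  rintro (rfl | rfl)
  · exact (hp.adj v hv).symm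
  · exact hp.adj u fun k => hv (by rw [k, k])

/-- If all vertices of even degree are roots, then the vertices other than the roots of even
degree can be paired with siblings, where a root of odd degree counts as its own child. -/
theorem IsParentMap.exists_isSiblingPairing [Fintype V] [DecidableRel G.Adj]
    {r : G.ConnectedComponent → V} {p : V → V} (hp : G.IsParentMap r p)
    (heven : ∀ v, Even (G.degree v) → p v = v) :
    ∃ τ s, IsSiblingPairing p {v | Even (G.degree v)} τ s := by
  classical
  obtain ⟨τ, s, h⟩ := exists_signed_pairing_fiberwise ({v | ¬ Even (G.degree v)} : Finset V) p <| by
    intro v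
    rw [Finset.filter_filter]
    by_cases hv : p v = v
    -- The fibre over a root is its neighbours and itself. A root of even degree is discarded,
    -- leaving its degree; a root of odd degree is kept, giving its degree plus one.
    · have hd := hp.neighborFinset_eq_of_root hv
      by_cases hev : Even (G.degree v)
      · convert hev using 1
        rw [← card_neighborFinset_eq_degree, hd]
        congr 1
        ext u
        simp only [Finset.mem_erase, Finset.mem_filter, Finset.mem_univ, true_and]
        refine ⟨fun ⟨h1, h2⟩ => ⟨fun k => h1 (k ▸ hev), h2⟩, fun ⟨h1, h2⟩ => ⟨fun k => ?_, h2⟩⟩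
        exact h1 ((heven u k).symm.trans h2)
      · have h2 : ({u | ¬ Even (G.degree u) ∧ p u = v} : Finset V) = ({u | p u = v} : Finset V) := by
          ext u
          simp only [Finset.mem_filter, Finset.mem_univ, true_and, and_iff_right_iff_imp]
          rintro rfl k
          rw [← heven u k] at k
          exact hev k
        rw [h2, ← Finset.card_erase_add_one (s := {u | p u = v}) (a := v) (by simpa using hv), ← hd,
          card_neighborFinset_eq_degree]
        exact (Nat.not_even_iff_odd.mp hev).add_one
    -- A non-root has odd degree, and its fibre omits one neighbour, the parent.
    · have hd := congrArg Finset.card (hp.neighborFinset_eq_of_not_root hv)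
      rw [card_neighborFinset_eq_degree, Finset.card_insert_of_notMem] at hd
      · have hev := mt (heven v) hv
        rw [hd, Nat.even_add_one, not_not] at hev
        convert hev using 1
        congr 1
        ext u
        simp only [Finset.mem_filter, Finset.mem_univ, true_and, and_iff_right_iff_imp]
        rintro rfl k
        exact hv (congrArg p (heven u k))
      · simp only [Finset.mem_filter, Finset.mem_univ, true_and]
        exact fun k => hv (hp.antisymm _ _ k rfl)
  simp only [Finset.mem_filter, Finset.mem_univ, true_and] at h
  exact ⟨τ, s, heven, fun u hu => (h u hu).1, fun u hu => (h u hu).2.1, fun u hu => (h u hu).2.2.1,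
    fun u hu => (h u hu).2.2.2.1, fun u hu => (h u hu).2.2.2.2⟩

end SimpleGraph

namespace SimpleGraph

variable {V : Type*} {G : SimpleGraph V} {r : G.ConnectedComponent → V} {p : V → V}

/-! ### The adapted complex structure defined by a sibling pairing -/

namespace IsParentMap

theorem mk_parent (hp : G.IsParentMap r p) (u : V) :
    G.connectedComponentMk (p u) = G.connectedComponentMk u := by
  by_cases h : p u = u
  · rw [h]
  · exact ConnectedComponent.sound (hp.adj u h).reachable

open Classical in
/-- The edge from the parent of `u` to `u`, or `0` if `u` is a root. -/
noncomputable def edge (hp : G.IsParentMap r p) (u : V) : G.LieAlg :=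
  if h : p u ≠ u then G.edgeVec (hp.adj u h) else 0

theorem edge_of_ne (hp : G.IsParentMap r p) {u : V} (h : p u ≠ u) :
    hp.edge u = G.edgeVec (hp.adj u h) :=
  dif_pos h

theorem fst_edge (hp : G.IsParentMap r p) (u : V) : (hp.edge u).1 = 0 := by
  unfold edge
  split_ifs <;> rfl

theorem lie_parent [Fintype V] (hp : G.IsParentMap r p) {u : V} (h : p u ≠ u) :
    ⁅G.vertexVec (p u), G.vertexVec u⁆ = hp.edge u := by
  rw [hp.edge_of_ne h, lie_vertexVec G (hp.adj u h)]

open Classical in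
/-- The vertex or edge of the component `c` that is not matched inside of `c`. -/
noncomputable def leftover (hp : G.IsParentMap r p) (E : Set V) (τ : V → V)
    (c : G.ConnectedComponent) : G.LieAlg :=
  if r c ∈ E then G.vertexVec (r c) else hp.edge (τ (r c))

open Classical in
/-- The endomorphism that acts on vertices and edges through the sibling pairing `τ`, and permutes
the leftover elements of the components through `π`. -/
noncomputable def complexStructure (hp : G.IsParentMap r p) (E : Set V) (τ : V → V) (s : V → ℝ)
    (π : G.ConnectedComponent → G.ConnectedComponent) (ε : G.ConnectedComponent → ℝ) :
    G.LieAlg →ₗ[ℝ] G.LieAlg :=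
  hp.basis.constr ℝ <| Sum.elim
    (fun u => if u ∈ E then
        ε (G.connectedComponentMk u) • hp.leftover E τ (π (G.connectedComponentMk u))
      else s u • G.vertexVec (τ u))
    (fun u => if p (τ u) = τ u then
        ε (G.connectedComponentMk u) • hp.leftover E τ (π (G.connectedComponentMk u))
      else s u • hp.edge (τ u))

variable {E : Set V} {τ : V → V} {s : V → ℝ} {π : G.ConnectedComponent → G.ConnectedComponent}
  {ε : G.ConnectedComponent → ℝ}

theorem parent_root (hp : G.IsParentMap r p) (c : G.ConnectedComponent) : p (r c) = r c :=
  (hp.eq_self_iff _).mpr (by rw [hp.mk_root])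

theorem mk_sibling (hp : G.IsParentMap r p) (hτ : IsSiblingPairing p E τ s) {u : V}
    (hu : u ∉ E) :
    G.connectedComponentMk (τ u) = G.connectedComponentMk u := by
  rw [← hp.mk_parent (τ u), hτ.parent u hu, hp.mk_parent]

variable (hp : G.IsParentMap r p)

theorem complexStructure_vertexVec_of_mem {u : V} (hu : u ∈ E) :
    hp.complexStructure E τ s π ε (G.vertexVec u) =
      ε (G.connectedComponentMk u) • hp.leftover E τ (π (G.connectedComponentMk u)) := by
  rw [complexStructure, ← hp.basis_inl, Module.Basis.constr_basis, Sum.elim_inl, if_pos hu]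

theorem complexStructure_vertexVec_of_notMem {u : V} (hu : u ∉ E) :
    hp.complexStructure E τ s π ε (G.vertexVec u) = s u • G.vertexVec (τ u) := by
  rw [complexStructure, ← hp.basis_inl, Module.Basis.constr_basis, Sum.elim_inl, if_neg hu]

theorem complexStructure_edge_of_root {u : V} (hu : p u ≠ u) (h : p (τ u) = τ u) :
    hp.complexStructure E τ s π ε (hp.edge u) =
      ε (G.connectedComponentMk u) • hp.leftover E τ (π (G.connectedComponentMk u)) := by
  rw [complexStructure, hp.edge_of_ne hu, ← hp.basis_inr ⟨u, hu⟩, Module.Basis.constr_basis,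
    Sum.elim_inr, if_pos h]

theorem complexStructure_edge_of_not_root {u : V} (hu : p u ≠ u) (h : p (τ u) ≠ τ u) :
    hp.complexStructure E τ s π ε (hp.edge u) = s u • hp.edge (τ u) := by
  rw [complexStructure, hp.edge_of_ne hu, ← hp.basis_inr ⟨u, hu⟩, Module.Basis.constr_basis,
    Sum.elim_inr, if_neg h]

theorem leftover_of_mem {u : V} (hτ : IsSiblingPairing p E τ s) (hu : u ∈ E) :
    hp.leftover E τ (G.connectedComponentMk u) = G.vertexVec u := by
  rw [leftover, ← (hp.eq_self_iff u).mp (hτ.root u hu), if_pos hu]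

/-- The partner of `u` is a root, which has no edge above it, so the edge above `u` is unmatched
within its component. -/
theorem leftover_of_root {u : V} (hτ : IsSiblingPairing p E τ s) (hu : p u ≠ u)
    (h : p (τ u) = τ u) : hp.leftover E τ (G.connectedComponentMk u) = hp.edge u := by
  have hE := hτ.notMem_of_ne hu
  rw [leftover, ← hp.mk_sibling hτ hE, ← (hp.eq_self_iff _).mp h, if_neg (hτ.notMem u hE),
    hτ.inv u hE]

theorem complexStructure_leftover (hτ : IsSiblingPairing p E τ s) (c : G.ConnectedComponent) :
    hp.complexStructure E τ s π ε (hp.leftover E τ c) = ε c • hp.leftover E τ (π c) := by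
  by_cases hc : r c ∈ E
  · rw [leftover, if_pos hc, hp.complexStructure_vertexVec_of_mem hc, hp.mk_root]
  · rw [leftover, if_neg hc, hp.complexStructure_edge_of_root
      (hτ.parent_ne_of_root hc (hp.parent_root c)) (by rw [hτ.inv _ hc, hp.parent_root]),
      hp.mk_sibling hτ hc, hp.mk_root]

theorem complexStructure_sq (hτ : IsSiblingPairing p E τ s) (hπ : ∀ c, π (π c) = c)
    (hε : ∀ c, ε c * ε (π c) = -1) (x : G.LieAlg) :
    hp.complexStructure E τ s π ε (hp.complexStructure E τ s π ε x) = -x := by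
  suffices h : hp.complexStructure E τ s π ε ∘ₗ hp.complexStructure E τ s π ε = -LinearMap.id from
    LinearMap.congr_fun h x
  refine hp.basis.ext ?_
  rintro (u | ⟨u, hu⟩)
  · rw [hp.basis_inl, LinearMap.comp_apply, LinearMap.neg_apply, LinearMap.id_apply]
    by_cases hE : u ∈ E
    · rw [hp.complexStructure_vertexVec_of_mem hE, map_smul, hp.complexStructure_leftover hτ,
        smul_smul, hε, hπ, hp.leftover_of_mem hτ hE, neg_one_smul]
    · rw [hp.complexStructure_vertexVec_of_notMem hE, map_smul,
        hp.complexStructure_vertexVec_of_notMem (hτ.notMem u hE), hτ.inv u hE, smul_smul,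
        hτ.sign_mul_sign hE, neg_one_smul]
  · rw [hp.basis_inr, LinearMap.comp_apply, LinearMap.neg_apply, LinearMap.id_apply,
      ← hp.edge_of_ne hu]
    have hE := hτ.notMem_of_ne hu
    by_cases h : p (τ u) = τ u
    · rw [hp.complexStructure_edge_of_root hu h, map_smul, hp.complexStructure_leftover hτ,
        smul_smul, hε, hπ, hp.leftover_of_root hτ hu h, neg_one_smul]
    · rw [hp.complexStructure_edge_of_not_root hu h, map_smul,
        hp.complexStructure_edge_of_not_root h (by rwa [hτ.inv u hE]), hτ.inv u hE, smul_smul,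
        hτ.sign_mul_sign hE, neg_one_smul]

theorem edge_mem {u : V} (hu : p u ≠ u) : hp.edge u ∈ G.vertexEdgeSet :=
  .inr ⟨_, _, _, hp.edge_of_ne hu⟩

theorem leftover_mem (hτ : IsSiblingPairing p E τ s) (c : G.ConnectedComponent) :
    hp.leftover E τ c ∈ G.vertexEdgeSet := by
  by_cases hc : r c ∈ E
  · exact .inl ⟨r c, by rw [leftover, if_pos hc]⟩
  · rw [leftover, if_neg hc]
    exact hp.edge_mem (hτ.parent_ne_of_root hc (hp.parent_root c))

theorem complexStructure_mem (hτ : IsSiblingPairing p E τ s) (hε : ∀ c, ε c = 1 ∨ ε c = -1)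
    {x : G.LieAlg} (hx : x ∈ G.vertexEdgeSet) :
    hp.complexStructure E τ s π ε x ∈ G.vertexEdgeSet ∨
      -hp.complexStructure E τ s π ε x ∈ G.vertexEdgeSet := by
  have hsm : ∀ (t : ℝ) (y : G.LieAlg), t = 1 ∨ t = -1 → y ∈ G.vertexEdgeSet →
      t • y ∈ G.vertexEdgeSet ∨ -(t • y) ∈ G.vertexEdgeSet := by
    rintro t y (rfl | rfl) hy
    · exact .inl (by rwa [one_smul])
    · exact .inr (by rwa [neg_one_smul, neg_neg])
  have hedge : ∀ u, p u ≠ u → hp.complexStructure E τ s π ε (hp.edge u) ∈ G.vertexEdgeSet ∨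
      -hp.complexStructure E τ s π ε (hp.edge u) ∈ G.vertexEdgeSet := by
    intro u hu
    by_cases h : p (τ u) = τ u
    · rw [hp.complexStructure_edge_of_root hu h]
      exact hsm _ _ (hε _) (hp.leftover_mem hτ _)
    · rw [hp.complexStructure_edge_of_not_root hu h]
      exact hsm _ _ (hτ.sign _ (hτ.notMem_of_ne hu)) (hp.edge_mem h)
  rcases hx with ⟨u, rfl⟩ | ⟨v, w, h, rfl⟩
  · by_cases hE : u ∈ E
    · rw [hp.complexStructure_vertexVec_of_mem hE]
      exact hsm _ _ (hε _) (hp.leftover_mem hτ _)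
    · rw [hp.complexStructure_vertexVec_of_notMem hE]
      exact hsm _ _ (hτ.sign _ hE) (.inl ⟨_, rfl⟩)
  · rcases hp.eq_or_eq v w h with k | k
    · subst k
      rw [← hp.edge_of_ne h.ne]
      exact hedge w h.ne
    · subst k
      rw [edgeVec_symm G h.symm, ← hp.edge_of_ne h.ne', map_neg, neg_neg]
      exact (hedge v h.ne').symm

variable [Fintype V]

/-- A leftover is either central or a vertex of another component. -/
theorem lie_leftover {u : V} {c : G.ConnectedComponent} (hc : G.connectedComponentMk u ≠ c) :
    ⁅hp.leftover E τ c, G.vertexVec u⁆ = 0 := by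
  by_cases h : r c ∈ E
  · rw [leftover, if_pos h]
    refine lie_vertexVec_of_not_adj G fun k => hc ?_
    rw [← hp.mk_root c]
    exact (ConnectedComponent.sound k.reachable).symm
  · rw [leftover, if_neg h]
    exact lie_eq_zero_left (hp.fst_edge _) _

/-- The image of the parent of `u` commutes with `u`. -/
theorem lie_complexStructure_parent (hτ : IsSiblingPairing p E τ s) (hπ : ∀ c, π c ≠ c)
    {u : V} (hu : p u ≠ u) :
    ⁅hp.complexStructure E τ s π ε (G.vertexVec (p u)), G.vertexVec u⁆ = 0 := by
  by_cases hE : p u ∈ E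
  · rw [hp.complexStructure_vertexVec_of_mem hE, smul_lie, hp.lie_leftover, smul_zero]
    rw [hp.mk_parent]
    exact (hπ _).symm
  · rw [hp.complexStructure_vertexVec_of_notMem hE, smul_lie, lie_vertexVec_of_not_adj, smul_zero]
    -- Adjacency would make `τ (p u)` the parent of `u`, hence a fixed point of `τ`, or make `u` the
    -- parent of `p u`.
    intro k
    rcases hp.eq_or_eq _ _ k with h | h
    · exact hτ.ne hE h.symm
    · rw [hτ.parent _ hE] at h
      exact hu (hp.antisymm _ _ h rfl)

/-- If the partner of `u` is the root, then `J u = ±p u`, and the tensor always vanishes on a vector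
and its image. Otherwise `J (p u)` commutes with `u` and `τ u`, and what remains is the edge above
`u` plus `s u * s (τ u) = -1` times itself. -/
theorem nijenhuis_complexStructure_parent (hτ : IsSiblingPairing p E τ s) (hπ : ∀ c, π c ≠ c)
    {u : V} (hu : p u ≠ u) :
    nijenhuis (hp.complexStructure E τ s π ε) (G.vertexVec (p u)) (G.vertexVec u) = 0 := by
  have hE := hτ.notMem_of_ne hu
  by_cases h : p (τ u) = τ u
  · have hv : p u = τ u := by rw [← hτ.parent u hE, h]
    have h1 : s u * s u = 1 := by rcases hτ.sign u hE with h | h <;> rw [h] <;> norm_num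
    rw [nijenhuis_apply, hv, hp.complexStructure_vertexVec_of_notMem hE,
      hp.complexStructure_vertexVec_of_notMem (hτ.notMem u hE), hτ.inv u hE, hτ.sign_neg u hE]
    simp only [smul_lie, neg_lie, lie_smul, lie_self, neg_zero, smul_zero, add_zero, map_zero,
      neg_smul]
    rw [smul_neg, smul_smul, h1, one_smul, sub_neg_eq_add, ← lie_skew, neg_add_cancel]
  · have h1 : ⁅hp.complexStructure E τ s π ε (G.vertexVec (p u)), G.vertexVec (τ u)⁆ = 0 := by
      have := hp.lie_complexStructure_parent (π := π) (ε := ε) hτ hπ h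
      rwa [hτ.parent u hE] at this
    have h2 : ⁅G.vertexVec (p u), G.vertexVec (τ u)⁆ = hp.edge (τ u) := by
      rw [← hτ.parent u hE, hp.lie_parent h]
    rw [nijenhuis_apply, hp.lie_complexStructure_parent hτ hπ hu, zero_add,
      hp.complexStructure_vertexVec_of_notMem hE, lie_smul, lie_smul, h1, h2, smul_zero, sub_zero,
      hp.lie_parent hu, map_smul,
      hp.complexStructure_edge_of_not_root h (by rwa [hτ.inv u hE]), hτ.inv u hE, smul_smul,
      hτ.sign_mul_sign hE, neg_one_smul, add_neg_cancel]

end IsParentMap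

/-- A forest with a sibling pairing and a pairing of its components admits an adapted complex
structure. -/
theorem IsSiblingPairing.admitsAdaptedComplexStructure [Fintype V] {E : Set V} {τ : V → V}
    {s : V → ℝ} (hτ : IsSiblingPairing p E τ s) (hp : G.IsParentMap r p)
    {π : G.ConnectedComponent → G.ConnectedComponent} {ε : G.ConnectedComponent → ℝ}
    (hπ : ∀ c, π (π c) = c) (hπε : ∀ c, ε (π c) = -ε c) (hε : ∀ c, ε c = 1 ∨ ε c = -1) :
    G.AdmitsAdaptedComplexStructure := by
  have hne : ∀ c, π c ≠ c := fun c h => by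
    have h1 := hπε c
    rw [h] at h1
    rcases hε c with h2 | h2 <;> rw [h2] at h1 <;> norm_num at h1
  have hmul : ∀ c, ε c * ε (π c) = -1 := fun c => by
    rw [hπε]
    rcases hε c with h | h <;> rw [h] <;> norm_num
  have hmem := fun x hx => hp.complexStructure_mem (π := π) hτ hε (x := x) hx
  refine ⟨hp.complexStructure E τ s π ε,
    isComplexStructure_of_adj (hp.complexStructure_sq hτ hπ hmul) hmem fun v u h => ?_, hmem⟩
  rcases hp.eq_or_eq v u h with k | k
  · subst k
    exact hp.nijenhuis_complexStructure_parent hτ hne h.ne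
  · subst k
    rw [nijenhuis_swap, hp.nijenhuis_complexStructure_parent hτ hne h.ne', neg_zero]

theorem IsAcyclic.admitsAdaptedComplexStructure [Fintype V] [DecidableRel G.Adj]
    (hG : G.IsAcyclic) (heven : Even (Nat.card G.ConnectedComponent))
    (hdeg : ∀ c : G.ConnectedComponent, {v : V | v ∈ c.supp ∧ Even (G.degree v)}.ncard ≤ 1) :
    G.AdmitsAdaptedComplexStructure := by
  classical
  -- The root is the vertex of even degree if there is one, and arbitrary otherwise.
  have hroot : ∀ c : G.ConnectedComponent, ∃ w, G.connectedComponentMk w = c ∧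
      ∀ v, G.connectedComponentMk v = c → Even (G.degree v) → v = w := by
    intro c
    by_cases h : ∃ w, G.connectedComponentMk w = c ∧ Even (G.degree w)
    · obtain ⟨w, hw, hw'⟩ := h
      exact ⟨w, hw, fun v hv hv' => Set.ncard_le_one (Set.toFinite _) |>.mp (hdeg c) v ⟨hv, hv'⟩ w ⟨hw, hw'⟩⟩
    · obtain ⟨w, hw⟩ := c.exists_rep
      exact ⟨w, hw, fun v hv hv' => absurd ⟨v, hv, hv'⟩ h⟩
  choose r hr hr' using hroot
  obtain ⟨p, hp⟩ := hG.exists_isParentMap r hr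
  obtain ⟨τ, s, hτ⟩ := hp.exists_isSiblingPairing fun v hv =>
    (hp.eq_self_iff v).mpr (hr' _ v rfl hv)
  rw [Nat.card_eq_fintype_card] at heven
  obtain ⟨π, ε, hπ⟩ := exists_signed_pairing (Finset.univ : Finset G.ConnectedComponent) heven
  exact hτ.admitsAdaptedComplexStructure hp (fun c => (hπ c (Finset.mem_univ c)).2.1)
    (fun c => (hπ c (Finset.mem_univ c)).2.2.1) fun c => (hπ c (Finset.mem_univ c)).2.2.2

end SimpleGraph

theorem theorem6p1 {V : Type*} [Fintype V] (G : SimpleGraph V) [DecidableRel G.Adj]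
    (hG : G.IsAcyclic) :
    G.AdmitsAdaptedComplexStructure ↔
      Even (Nat.card G.ConnectedComponent) ∧
        ∀ c : G.ConnectedComponent, {v : V | v ∈ c.supp ∧ Even (G.degree v)}.ncard ≤ 1 :=
  ⟨fun h => ⟨h.even_card_connectedComponent hG, h.ncard_even_degree_le_one hG⟩,
    fun h => hG.admitsAdaptedComplexStructure h.1 h.2⟩
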